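/- A finite dimensional reproducing kernel Hilbert space (RKHS) $H$ is a finite dimensional complex inner product space together with a distinguished basis $\{k_x\}_{x\in X}$ of kernel functions indexed by a finite set $X=X(H)$, such that $k_{xy}:=\langle k_x,k_y\rangle\neq 0$ for all $x\neq y$ in $X$. Vectors $h\in H$ are regarded as functions on $X$ by $h(x)=\langle h,k_x\rangle$ (inner products are linear in the first variable). For $Y\subseteq X$ let $H_Y$ be the span of $\{k_y\}_{y\in Y}$, with these kernel functions. A function $m:X\to\mathbb{C}^{s\times t}$ is the symbol of the matrix-valued multiplier $M_m:H\otimes\mathbb{C}^t\to H\otimes\mathbb{C}^s$, $(M_mh)(x)=m(x)h(x)$. The space $H$ has the complete Pick property (CPP) if for all $s,t$, all $Y\subseteq X$ and every $w:Y\to\mathbb{C}^{s\times t}$ whose multiplier on $H_Y$ has operator norm $1$, there is $m:X\to\mathbb{C}^{s\times t}$ with $m|_Y=w$ whose multiplier on $H$ has operator norm $1$. An RKHS $\widetilde H$ is a rescaling of $H$, written $H\sim\widetilde H$, if there are a bijection $\Xi:X(H)\to X(\widetilde H)$ and a nonvanishing $\gamma:X(H)\to\mathbb{C}$ with $\tilde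 k_{\Xi(x)\Xi(y)}=\gamma(x)\overline{\gamma(y)}\,k_{xy}$ for all $x,y\in X(H)$. Let $\mathbb{CH}^n$ be complex hyperbolic space in its ball model, i.e. the open unit ball of $\mathbb{C}^n$; let $DA_n$ be the Drury–Arveson space, the Hilbert space of functions on this ball with reproducing kernel $k_z(w)=(1-\langle w,z\rangle)^{-1}$; and for finite $Y\subset\mathbb{CH}^n$ let $DA_n(Y)$ be the subspace of $DA_n$ spanned by $\{k_y\}_{y\in Y}$, with these kernel functions. **Theorem 5.9.** If $H^+$ is a finite dimensional RKHS with the CPP, then there are an integer $n\ge 1$ and a finite set $X^+\subset\mathbb{CH}^n$ such that $H^+\sim DA_n(X^+)$. -/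

import Mathlib

open scoped ComplexConjugate

noncomputable section

/-- An RKHS with kernel functions indexed by `X`: a complex inner product space `H` together with
a distinguished basis `(k_x)_{x ∈ X}` of reproducing kernels, which is irreducible: the inner
products `⟨k_x, k_y⟩` do not vanish (linear independence of `k_x`, `k_y` for `x ≠ y` is part of
being a basis). It is finite dimensional exactly when `X` is finite. -/
structure KernelSpace (X H : Type*) [NormedAddCommGroup H] [InnerProductSpace ℂ H] where
  ker : Module.Basis X ℂ H
  irreducible : ∀ x y, x ≠ y → inner ℂ (ker x) (ker y) ≠ 0

namespace KernelSpace

section Basic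

variable {X H : Type*} [NormedAddCommGroup H] [InnerProductSpace ℂ H]

/-- The value `h(x) = ⟨h, k_x⟩` of `h ∈ H` at `x ∈ X`. (Mathlib's inner product is linear in the
second variable, the usual one here is linear in the first, whence the order.) -/
def value (K : KernelSpace X H) (h : H) (x : X) : ℂ := inner ℂ (K.ker x) h

/-- The Gram matrix entry `k_{xy} = ⟨k_x, k_y⟩ = k_x(y)`. -/
def gram (K : KernelSpace X H) (x y : X) : ℂ := K.value (K.ker x) y

/-- The vectors of `H` regarded as functions on the finite set `X`; every function on `X` arises
from exactly one vector. -/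
def funEquiv [Finite X] (K : KernelSpace X H) : H ≃ₗ[ℂ] (X → ℂ) :=
  haveI : FiniteDimensional ℂ H := Module.Basis.finiteDimensional_of_finite K.ker
  LinearMap.linearEquivOfInjective
    { toFun := fun h x => K.value h x
      map_add' := fun _ _ => funext fun _ => inner_add_right _ _ _
      map_smul' := fun _ _ => funext fun _ => inner_smul_right _ _ _ }
    (by
      intro f g h
      exact InnerProductSpace.ext_inner_left_basis K.ker fun x => congrFun h x)
    (by
      have := Fintype.ofFinite X
      rw [Module.finrank_eq_card_basis K.ker, Module.finrank_fintype_fun_eq_card])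

@[simp]
theorem funEquiv_apply [Finite X] (K : KernelSpace X H) (h : H) (x : X) :
    K.funEquiv h x = K.value h x := rfl

/-- For `Y ⊆ X`, the space `H_Y`: the span of `{k_y : y ∈ Y}` with these kernel functions. -/
def restrict (K : KernelSpace X H) (Y : Set X) :
    KernelSpace Y (Submodule.span ℂ (Set.range fun y : Y => K.ker y)) where
  ker := Module.Basis.span (K.ker.linearIndependent.comp _ Subtype.val_injective)
  irreducible := by
    intro x y hxy
    rw [Submodule.coe_inner, Module.Basis.span_apply, Module.Basis.span_apply]
    exact K.irreducible x y fun h => hxy (Subtype.ext h)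

/-- The matrix-valued multiplier operator `M_m : H ⊗ ℂᵗ → H ⊗ ℂˢ` with symbol
`m : X → ℂ^{s × t}`, that is `(M_m h)(x) = m(x) h(x)`. Here `H ⊗ ℂᵗ` is the Hilbert space
of `t`-tuples of vectors of `H`. The scalar multipliers are those with `s = t = 1`. -/
def multiplier [Finite X] (K : KernelSpace X H) {s t : ℕ} (m : X → Matrix (Fin s) (Fin t) ℂ) :
    PiLp 2 (fun _ : Fin t => H) →L[ℂ] PiLp 2 (fun _ : Fin s => H) :=
  haveI : FiniteDimensional ℂ H := Module.Basis.finiteDimensional_of_finite K.ker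
  LinearMap.toContinuousLinearMap
    { toFun := fun h => WithLp.toLp 2 fun i =>
        K.funEquiv.symm fun x => (m x).mulVec (fun j => K.value (h j) x) i
      map_add' := fun f g => by
        ext i
        simp only [PiLp.add_apply]
        rw [← map_add]
        congr 1
        funext x
        simp [value, Matrix.mulVec, dotProduct, mul_add, Finset.sum_add_distrib]
      map_smul' := fun c f => by
        ext i
        simp only [PiLp.smul_apply, RingHom.id_apply]
        rw [← map_smul]
        congr 1
        funext x
        simp [value, Matrix.mulVec, dotProduct, Finset.mul_sum, mul_left_comm] }

/-- `(M_m h)(x) = m(x) h(x)`. -/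
theorem value_multiplier [Finite X] (K : KernelSpace X H) {s t : ℕ}
    (m : X → Matrix (Fin s) (Fin t) ℂ) (h : PiLp 2 (fun _ : Fin t => H)) (i : Fin s) (x : X) :
    K.value (K.multiplier m h i) x = (m x).mulVec (fun j => K.value (h j) x) i :=
  congrFun (K.funEquiv.apply_symm_apply fun x => (m x).mulVec (fun j => K.value (h j) x) i) x

/-- The complete Pick property: for all matrix sizes `s × t` and all `Y ⊆ X`, every matrix-valued
multiplier of `H_Y` of operator norm one is the restriction of a matrix-valued multiplier of `H`
of operator norm one. -/
def CompletePick [Finite X] (K : KernelSpace X H) : Prop :=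
  ∀ (s t : ℕ) (Y : Set X) (w : Y → Matrix (Fin s) (Fin t) ℂ),
    ‖(K.restrict Y).multiplier w‖ = 1 →
      ∃ m : X → Matrix (Fin s) (Fin t) ℂ, ‖K.multiplier m‖ = 1 ∧ ∀ y : Y, m y = w y

/-- `K ∼ K'`: `K'` is a rescaling of `K`. -/
def Rescales {X' H' : Type*} [NormedAddCommGroup H'] [InnerProductSpace ℂ H']
    (K : KernelSpace X H) (K' : KernelSpace X' H') : Prop :=
  ∃ (Ξ : X ≃ X') (γ : X → ℂ), (∀ x, γ x ≠ 0) ∧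
    ∀ x y, K'.gram (Ξ x) (Ξ y) = γ x * conj (γ y) * K.gram x y

end Basic

end KernelSpace

/-- The points of complex hyperbolic space `ℂℍⁿ` in its ball model: the open unit ball of `ℂⁿ`.
Only the underlying set matters here, not the hyperbolic metric. -/
abbrev CHyp (n : ℕ) : Type := Metric.ball (0 : EuclideanSpace ℂ (Fin n)) 1

namespace CHyp

theorem norm_inner_lt_one {n : ℕ} (z w : CHyp n) :
    ‖inner ℂ (z : EuclideanSpace ℂ (Fin n)) (w : EuclideanSpace ℂ (Fin n))‖ < 1 := by
  have hz : ‖(z : EuclideanSpace ℂ (Fin n))‖ < 1 := mem_ball_zero_iff.1 z.2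
  have hw : ‖(w : EuclideanSpace ℂ (Fin n))‖ < 1 := mem_ball_zero_iff.1 w.2
  refine (norm_inner_le_norm _ _).trans_lt ?_
  nlinarith [norm_nonneg (z : EuclideanSpace ℂ (Fin n)),
    norm_nonneg (w : EuclideanSpace ℂ (Fin n))]

theorem one_sub_inner_ne_zero {n : ℕ} (z w : CHyp n) :
    1 - inner ℂ (z : EuclideanSpace ℂ (Fin n)) (w : EuclideanSpace ℂ (Fin n)) ≠ 0 := by
  intro h
  have := norm_inner_lt_one z w
  rw [← sub_eq_zero.1 h] at this
  simp at this

end CHyp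

/-- The Drury-Arveson kernel `k_z(w) = 1 / (1 - ⟨w, z⟩)` on the ball, entry `(w, z)`, as an
operator-valued kernel on the one dimensional space `ℂ`. -/
def daKernel (n : ℕ) : Matrix (CHyp n) (CHyp n) (ℂ →L[ℂ] ℂ) :=
  .of fun w z => (1 - inner ℂ (z : EuclideanSpace ℂ (Fin n)) (w : EuclideanSpace ℂ (Fin n)))⁻¹ •
    ContinuousLinearMap.id ℂ ℂ

theorem daKernel_pow_nonneg {n : ℕ} (s : Finset (CHyp n)) (c : CHyp n → ℂ) (m : ℕ) :
    0 ≤ (∑ z ∈ s, ∑ w ∈ s, conj (c z) * c w *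
      (inner ℂ (z : EuclideanSpace ℂ (Fin n)) (w : EuclideanSpace ℂ (Fin n))) ^ m).re := by
  classical
  induction m generalizing c with
  | zero =>
    have : (∑ z ∈ s, ∑ w ∈ s, conj (c z) * c w *
        (inner ℂ (z : EuclideanSpace ℂ (Fin n)) (w : EuclideanSpace ℂ (Fin n))) ^ 0)
        = ((Complex.normSq (∑ z ∈ s, c z) : ℝ) : ℂ) := by
      rw [Complex.normSq_eq_conj_mul_self, map_sum, Finset.sum_mul_sum]
      simp
    rw [this, Complex.ofReal_re]
    exact Complex.normSq_nonneg _
  | succ m ih =>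
    have : (∑ z ∈ s, ∑ w ∈ s, conj (c z) * c w *
        (inner ℂ (z : EuclideanSpace ℂ (Fin n)) (w : EuclideanSpace ℂ (Fin n))) ^ (m + 1))
        = ∑ i, ∑ z ∈ s, ∑ w ∈ s, conj (c z * z.1 i) * (c w * w.1 i) *
        (inner ℂ (z : EuclideanSpace ℂ (Fin n)) (w : EuclideanSpace ℂ (Fin n))) ^ m := by
      rw [Finset.sum_comm (s := Finset.univ)]
      refine Finset.sum_congr rfl fun z _ => ?_
      rw [Finset.sum_comm (s := Finset.univ)]
      refine Finset.sum_congr rfl fun w _ => ?_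
      rw [← Finset.sum_mul, pow_succ, mul_comm (_ ^ m), ← mul_assoc]
      congr 1
      rw [PiLp.inner_apply, Finset.mul_sum]
      refine Finset.sum_congr rfl fun i _ => ?_
      simp [RCLike.inner_apply]
      ring
    rw [this, Complex.re_sum]
    exact Finset.sum_nonneg fun i _ => ih _

open scoped ComplexOrder in
theorem daKernel_posSemidef (n : ℕ) : (daKernel n).PosSemidef := by
  have tfae := RKHS.posSemidef_tfae (K := daKernel n)
  refine (tfae.out 0 2 rfl rfl).2 ⟨?_, fun c => ?_⟩
  · ext z w
    simp [daKernel, ContinuousLinearMap.star_eq_adjoint, ContinuousLinearMap.adjoint_id]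
  · simp only [Finsupp.sum]
    have key : HasSum (fun m : ℕ => ∑ z ∈ c.support, ∑ w ∈ c.support,
        conj (conj (c z)) * conj (c w) *
        (inner ℂ (z : EuclideanSpace ℂ (Fin n)) (w : EuclideanSpace ℂ (Fin n))) ^ m)
        (∑ z ∈ c.support, ∑ w ∈ c.support, inner ℂ (daKernel n z w (c w)) (c z)) := by
      refine hasSum_sum fun z _ => hasSum_sum fun w _ => ?_
      have := (hasSum_geometric_of_norm_lt_one (CHyp.norm_inner_lt_one z w)).mul_left
        (conj (conj (c z)) * conj (c w))
      have h : inner ℂ (daKernel n z w (c w)) (c z) = conj (conj (c z)) * conj (c w) *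
          (1 - inner ℂ (z : EuclideanSpace ℂ (Fin n)) (w : EuclideanSpace ℂ (Fin n)))⁻¹ := by
        simp [daKernel]
        ring
      rwa [h]
    rw [Finset.sum_comm]
    exact (Complex.hasSum_re key).nonneg fun m =>
      daKernel_pow_nonneg c.support (fun z => conj (c z)) m

instance fact_daKernel_posSemidef (n : ℕ) : Fact (daKernel n).PosSemidef := ⟨daKernel_posSemidef n⟩

/-- The Drury-Arveson space `DA_n`: the reproducing kernel Hilbert space of functions on the ball
with the Drury-Arveson kernel. -/
abbrev DruryArveson (n : ℕ) : Type := RKHS.OfKernel (daKernel n)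

/-- The reproducing kernel `k_z ∈ DA_n`. -/
def daKer {n : ℕ} (z : CHyp n) : DruryArveson n := RKHS.kerFun (DruryArveson n) z 1

theorem daKer_apply {n : ℕ} (z w : CHyp n) :
    daKer z w = (1 - inner ℂ (z : EuclideanSpace ℂ (Fin n))
      (w : EuclideanSpace ℂ (Fin n)))⁻¹ := by
  rw [daKer, RKHS.kerFun_apply, RKHS.OfKernel.kernel_ofKernel]
  simp [daKernel]

theorem inner_daKer {n : ℕ} (z : CHyp n) (f : DruryArveson n) : inner ℂ (daKer z) f = f z := by
  rw [daKer, RKHS.kerFun_inner]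
  simp

theorem linearIndependent_daKer (n : ℕ) : LinearIndependent ℂ (daKer (n := n)) := by
  classical
  rw [linearIndependent_iff']
  intro S g hg
  -- a direction `v` on which the points of `S` have distinct projections
  obtain ⟨v, hv⟩ := Module.Dual.exists_forall_ne_zero_of_forall_exists (K := ℂ)
    (M := EuclideanSpace ℂ (Fin n))
    (fun p : {p : S × S // p.1 ≠ p.2} =>
      (innerSL ℂ ((p.1.1.1.1 : EuclideanSpace ℂ (Fin n)) - p.1.2.1.1)).toLinearMap)
    (fun p => ⟨(p.1.1.1.1 : EuclideanSpace ℂ (Fin n)) - p.1.2.1.1, by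
      have hp : (p.1.1.1.1 : EuclideanSpace ℂ (Fin n)) - p.1.2.1.1 ≠ 0 := fun h =>
        p.2 (Subtype.ext (Subtype.ext (sub_eq_zero.1 h)))
      exact fun h => hp (inner_self_eq_zero.1 h)⟩)
  set a : CHyp n → ℂ := fun z => inner ℂ (z : EuclideanSpace ℂ (Fin n)) v with ha
  have hinj : ∀ z ∈ S, ∀ w ∈ S, z ≠ w → a z ≠ a w := by
    intro z hz w hw hzw h
    refine hv ⟨(⟨z, hz⟩, ⟨w, hw⟩), fun h => hzw (congrArg Subtype.val h)⟩ ?_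
    simpa [inner_sub_left, sub_eq_zero] using h
  let P : Polynomial ℂ := ∑ z ∈ S, Polynomial.C (g z) *
    ∏ w ∈ S.erase z, (Polynomial.X - Polynomial.C (a w))
  have hP : P = 0 := by
    refine Polynomial.eq_zero_of_infinite_isRoot P ?_
    refine Set.Infinite.mono (s := (fun r : ℝ => (r : ℂ)) '' Set.Ioi (‖v‖ + 1)) ?_
      ((Set.Ioi_infinite _).image Complex.ofReal_injective.injOn)
    rintro _ ⟨r, hr, rfl⟩
    have hr : ‖v‖ + 1 < r := hr
    have hr0 : 0 < r := by linarith [norm_nonneg v]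
    have hrC : (r : ℂ) ≠ 0 := by exact_mod_cast hr0.ne'
    have hball : ((r : ℂ)⁻¹ • v) ∈ Metric.ball (0 : EuclideanSpace ℂ (Fin n)) 1 := by
      rw [mem_ball_zero_iff, norm_smul, norm_inv, Complex.norm_real, Real.norm_of_nonneg hr0.le,
        inv_mul_lt_iff₀ hr0]
      linarith
    have hne : ∀ z : CHyp n, (r : ℂ) - a z ≠ 0 := by
      intro z h
      have := CHyp.one_sub_inner_ne_zero z ⟨_, hball⟩
      apply this
      rw [inner_smul_right]
      change 1 - (r : ℂ)⁻¹ * a z = 0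
      rw [← sub_eq_zero.1 h, inv_mul_cancel₀ hrC, sub_self]
    have h0 : ∑ z ∈ S, g z * (r / (r - a z)) = 0 := by
      have h1 : inner ℂ (daKer (⟨_, hball⟩ : CHyp n)) (∑ z ∈ S, g z • daKer z) = 0 := by
        rw [hg, inner_zero_right]
      rw [inner_sum] at h1
      rw [← h1]
      refine Finset.sum_congr rfl fun z _ => ?_
      rw [inner_smul_right, inner_daKer, daKer_apply, inner_smul_right]
      change _ = g z * (1 - (r : ℂ)⁻¹ * a z)⁻¹
      congr 1
      rw [← div_eq_inv_mul, one_sub_div hrC, inv_div]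
    have h2 : (r : ℂ) * P.eval (r : ℂ) = (∏ w ∈ S, ((r : ℂ) - a w)) *
        ∑ z ∈ S, g z * (r / (r - a z)) := by
      simp only [P, Polynomial.eval_finsetSum, Polynomial.eval_mul, Polynomial.eval_C,
        Polynomial.eval_prod, Polynomial.eval_sub, Polynomial.eval_X, Finset.mul_sum]
      refine Finset.sum_congr rfl fun z hz => ?_
      rw [← Finset.mul_prod_erase S _ hz]
      have := hne z
      field_simp
    rw [h0, mul_zero] at h2
    exact (mul_eq_zero.1 h2).resolve_left hrC
  intro z hz
  have h := congrArg (Polynomial.eval (a z)) hP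
  simp only [P, Polynomial.eval_finsetSum, Polynomial.eval_mul, Polynomial.eval_C,
    Polynomial.eval_prod, Polynomial.eval_sub, Polynomial.eval_X, Polynomial.eval_zero] at h
  rw [Finset.sum_eq_single_of_mem z hz] at h
  · refine (mul_eq_zero.1 h).resolve_right (Finset.prod_ne_zero_iff.2 fun w hw => ?_)
    exact sub_ne_zero.2 (hinj z hz w (Finset.mem_of_mem_erase hw) (Finset.ne_of_mem_erase hw).symm)
  · intro w _ hwz
    rw [Finset.prod_eq_zero (Finset.mem_erase.2 ⟨hwz.symm, hz⟩) (sub_self _), mul_zero]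

/-- `DA_n(Y)`: the subspace of `DA_n` spanned by the kernel functions `k_y`, `y ∈ Y`. -/
def DA (n : ℕ) (Y : Set (CHyp n)) :
    KernelSpace Y (Submodule.span ℂ (Set.range fun y : Y => daKer (y : CHyp n))) where
  ker := Module.Basis.span ((linearIndependent_daKer n).comp _ Subtype.val_injective)
  irreducible := by
    intro x y _
    rw [Submodule.coe_inner, Module.Basis.span_apply, Module.Basis.span_apply]
    change inner ℂ (daKer (x : CHyp n)) (daKer (y : CHyp n)) ≠ 0
    rw [inner_daKer, daKer_apply]
    exact inv_ne_zero (CHyp.one_sub_inner_ne_zero _ _)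

end

/-!
If the McCullough–Quiggin matrix `1 - k_{x x₀} k_{x₀ y} / (k_{xy} k_{x₀ x₀})` is positive, it is the
Gram matrix of vectors `b_x`; solving for `k_{xy}` gives `(1 - ⟨b_x, b_y⟩)⁻¹` up to rescaling, and
the diagonal entries force `‖b_x‖ < 1`.

To prove its positivity on a subset `S` of the points, suppose that this is known there for the
base point `x₁`. The Gram vectors are then the values of a contractive row multiplier on the span
of the kernels in `S`, because its defect `k_{x x₁} k_{x₁ y} / k_{x₁ x₁}` is positive of rank one.
An extension to a contractive row multiplier of the whole space remains contractive on the
functions vanishing at another point `x₀`; in the resulting inequality the same rank one factor can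
be divided out, and what is left is the McCullough–Quiggin matrix for `x₀` on `S`. Since the row and
column of the base point vanish, `x₁` can be adjoined to `S` without losing positivity, so induction
on `S` applies.
-/

section Matrix

open Matrix
open scoped ComplexOrder

variable {𝕜 X : Type*} [RCLike 𝕜]

open scoped MatrixOrder in
theorem exists_gram_eq_of_posSemidef [Finite X] {A : Matrix X X 𝕜} (hA : A.PosSemidef) :
    ∃ b : X → EuclideanSpace 𝕜 (Fin (Nat.card X)), gram 𝕜 b = A := by
  classical
  have := Fintype.ofFinite X
  obtain ⟨B, rfl⟩ := CStarAlgebra.nonneg_iff_eq_star_mul_self.mp hA.nonneg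
  refine ⟨fun x => WithLp.toLp 2 fun j => B ((Finite.equivFin X).symm j) x, ?_⟩
  ext x y
  rw [gram_apply, EuclideanSpace.inner_toLp_toLp, Matrix.mul_apply, dotProduct_comm]
  exact Fintype.sum_equiv (Finite.equivFin X).symm _ _ fun _ => rfl

theorem posSemidef_submatrix_insert {A : Matrix X X 𝕜} {S : Set X} [Finite S] {x₁ : X}
    (hrow : ∀ y, A x₁ y = 0) (hcol : ∀ x, A x x₁ = 0)
    (hA : (A.submatrix ((↑) : S → X) (↑)).PosSemidef) :
    (A.submatrix ((↑) : ↥(insert x₁ S) → X) (↑)).PosSemidef := by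
  classical
  obtain ⟨b, hb⟩ := exists_gram_eq_of_posSemidef hA
  let b' (x : X) := if h : x ∈ S then b ⟨x, h⟩ else 0
  have hb'_zero {x : X} (hx : x ∉ S) : b' x = 0 := dif_neg hx
  have hb' {x y : X} (hx : x ∈ S) (hy : y ∈ S) : inner 𝕜 (b' x) (b' y) = A x y := by
    simp only [b', dif_pos hx, dif_pos hy]
    exact congrFun₂ hb ⟨x, hx⟩ ⟨y, hy⟩
  convert posSemidef_gram 𝕜 fun x : ↥(insert x₁ S) => b' x using 1
  ext ⟨x, hx⟩ ⟨y, hy⟩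
  change A x y = inner 𝕜 (b' x) (b' y)
  by_cases hxS : x ∈ S
  · by_cases hyS : y ∈ S
    · exact (hb' hxS hyS).symm
    · rw [hb'_zero hyS, inner_zero_right, hy.resolve_right hyS, hcol]
  · rw [hb'_zero hxS, inner_zero_left, hx.resolve_right hxS, hrow]

theorem norm_le_one_iff_posSemidef_gram_sub_gram [Finite X] {E F : Type*}
    [NormedAddCommGroup E] [InnerProductSpace 𝕜 E] [NormedAddCommGroup F] [InnerProductSpace 𝕜 F]
    (e : Module.Basis X 𝕜 E) (T : E →L[𝕜] F) :
    ‖T‖ ≤ 1 ↔ (gram 𝕜 e - gram 𝕜 (T ∘ e)).PosSemidef := by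
  have := Fintype.ofFinite X
  constructor
  · intro hT
    have hT' : 0 ≤ 1 - ‖T‖ ^ 2 := sub_nonneg.2 (pow_le_one₀ (norm_nonneg T) hT)
    convert (posSemidef_opNorm_smul_gram_sub_gram e T).add ((posSemidef_gram 𝕜 e).smul hT') using 1
    module
  · intro h
    refine T.opNorm_le_bound zero_le_one fun v => ?_
    have hv := h.dotProduct_mulVec_nonneg (e.repr v)
    have hTv : ∑ x, e.repr v x • (T ∘ e) x = T v := by
      simp only [Function.comp_apply, ← map_smul, ← map_sum, e.sum_repr]
    rw [sub_mulVec, dotProduct_sub, star_dotProduct_gram_mulVec, star_dotProduct_gram_mulVec,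
      e.sum_repr, hTv, inner_self_eq_norm_sq_to_K, inner_self_eq_norm_sq_to_K, sub_nonneg] at hv
    rw [one_mul, ← sq_le_sq₀ (norm_nonneg _) (norm_nonneg _)]
    exact_mod_cast hv

/-- The Schur complement of the entry at `(x₀, x₀)`, with the vanishing row and column at `x₀`
kept. If `G` is the kernel of a space of functions, this is the kernel of the subspace of functions
vanishing at `x₀`. -/
def vanishingKernel (G : Matrix X X 𝕜) (x₀ : X) : Matrix X X 𝕜 :=
  of fun x y => G x y - G x x₀ * G x₀ y / G x₀ x₀

/-- The McCullough–Quiggin matrix of a kernel `G` without zeros: the entrywise quotient of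
`vanishingKernel G x₀` by `G`. Its positivity characterizes complete Pick kernels. -/
def mcCulloughQuiggin (G : Matrix X X 𝕜) (x₀ : X) : Matrix X X 𝕜 :=
  of fun x y => 1 - G x x₀ * G x₀ y / (G x y * G x₀ x₀)

section Kernels

variable {G : Matrix X X 𝕜} {x₀ : X}

theorem vanishingKernel_apply (G : Matrix X X 𝕜) (x₀ x y : X) :
    vanishingKernel G x₀ x y = G x y - G x x₀ * G x₀ y / G x₀ x₀ :=
  rfl

theorem vanishingKernel_self_left (h₀ : G x₀ x₀ ≠ 0) (y : X) : vanishingKernel G x₀ x₀ y = 0 := by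
  rw [vanishingKernel_apply, mul_div_cancel_left₀ _ h₀, sub_self]

theorem vanishingKernel_self_right (h₀ : G x₀ x₀ ≠ 0) (x : X) : vanishingKernel G x₀ x x₀ = 0 := by
  rw [vanishingKernel_apply, mul_div_cancel_right₀ _ h₀, sub_self]

theorem mcCulloughQuiggin_hadamard (hG : ∀ x y, G x y ≠ 0) :
    mcCulloughQuiggin G x₀ ⊙ G = vanishingKernel G x₀ := by
  ext x y
  have := hG x y
  have := hG x₀ x₀
  simp only [hadamard_apply, mcCulloughQuiggin, vanishingKernel, of_apply]
  field_simp

theorem mcCulloughQuiggin_self_left (hG : ∀ x y, G x y ≠ 0) (y : X) :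
    mcCulloughQuiggin G x₀ x₀ y = 0 := by
  rw [mcCulloughQuiggin, of_apply, mul_comm (G x₀ x₀),
    div_self (mul_ne_zero (hG _ _) (hG _ _)), sub_self]

theorem mcCulloughQuiggin_self_right (hG : ∀ x y, G x y ≠ 0) (x : X) :
    mcCulloughQuiggin G x₀ x x₀ = 0 := by
  rw [mcCulloughQuiggin, of_apply, div_self (mul_ne_zero (hG _ _) (hG _ _)), sub_self]

theorem posSemidef_vanishingKernel [Finite X] (hG : G.PosSemidef) :
    (vanishingKernel G x₀).PosSemidef := by
  obtain ⟨b, rfl⟩ := exists_gram_eq_of_posSemidef hG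
  let P := (𝕜 ∙ b x₀)ᗮ.starProjection
  have hP (v : EuclideanSpace 𝕜 (Fin (Nat.card X))) :
      P v = v - (inner 𝕜 (b x₀) v / inner 𝕜 (b x₀) (b x₀)) • b x₀ := by
    rw [Submodule.starProjection_orthogonal_val, Submodule.starProjection_singleton,
      inner_self_eq_norm_sq_to_K, RCLike.ofReal_pow]
  convert posSemidef_gram 𝕜 (P ∘ b) using 1
  ext x y
  have hPP : inner 𝕜 (P (b x)) (P (b y)) = inner 𝕜 (b x) (P (b y)) := by
    rw [Submodule.inner_starProjection_left_eq_right,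
      Submodule.starProjection_eq_self_iff.2 (Submodule.starProjection_apply_mem _ _)]
  rw [gram_apply, Function.comp_apply, Function.comp_apply, hPP, hP, inner_sub_right,
    inner_smul_right, vanishingKernel, of_apply]
  simp only [gram_apply]
  ring

theorem sub_vanishingKernel (hG : G.IsHermitian) :
    G - vanishingKernel G x₀ = (G x₀ x₀)⁻¹ • vecMulVec (G · x₀) (star (G · x₀)) := by
  ext x y
  have hy : star (G y x₀) = G x₀ y := hG.apply x₀ y
  simp [vanishingKernel, vecMulVec_apply, hy, div_eq_inv_mul]

theorem posSemidef_sub_vanishingKernel [Finite X] (hG : G.PosSemidef) :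
    (G - vanishingKernel G x₀).PosSemidef := by
  rw [sub_vanishingKernel hG.isHermitian]
  exact (posSemidef_vecMulVec_self_star _).smul (inv_nonneg.2 hG.diag_nonneg)

theorem posSemidef_vanishingKernel_sub_hadamard [Finite X] {B : Matrix X X 𝕜}
    (h₀ : G x₀ x₀ ≠ 0) (hG : G.PosSemidef) (hB : B.PosSemidef) (hBG : (G - B ⊙ G).PosSemidef) :
    (vanishingKernel G x₀ - B ⊙ vanishingKernel G x₀).PosSemidef := by
  have h : (G - B ⊙ vanishingKernel G x₀).PosSemidef := by
    convert hBG.add (hB.hadamard (posSemidef_sub_vanishingKernel (x₀ := x₀) hG)) using 1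
    ext x y
    simp only [Matrix.sub_apply, Matrix.add_apply, hadamard_apply]
    ring
  convert posSemidef_vanishingKernel (x₀ := x₀) h using 1
  ext x y
  simp only [vanishingKernel_apply (G - _), Matrix.sub_apply, hadamard_apply,
    vanishingKernel_self_left h₀, vanishingKernel_self_right h₀, mul_zero, sub_zero]
  rw [vanishingKernel_apply]
  ring

theorem posSemidef_of_posSemidef_vecMulVec_hadamard [Finite X] {a : X → 𝕜} (ha : ∀ x, a x ≠ 0)
    {M : Matrix X X 𝕜} (h : (vecMulVec a (star a) ⊙ M).PosSemidef) : M.PosSemidef := by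
  convert (posSemidef_vecMulVec_self_star a⁻¹).hadamard h using 1
  ext x y
  have := ha x
  have := star_ne_zero.2 (ha y)
  simp only [hadamard_apply, vecMulVec_apply, Pi.star_apply, Pi.inv_apply, star_inv₀]
  field_simp

theorem posSemidef_of_sub_vanishingKernel_hadamard {Y : Type*} [Finite Y] {f : Y → X}
    (hG : G.PosSemidef) (h₀ : ∀ x, G x x₀ ≠ 0) {M : Matrix Y Y 𝕜}
    (h : ((G - vanishingKernel G x₀).submatrix f f ⊙ M).PosSemidef) : M.PosSemidef := by
  refine posSemidef_of_posSemidef_vecMulVec_hadamard (a := fun y => G (f y) x₀)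
    (fun y => h₀ (f y)) ?_
  convert h.smul (hG.diag_nonneg (i := x₀)) using 1
  rw [sub_vanishingKernel hG.isHermitian, submatrix_smul, Pi.smul_apply, Pi.smul_apply,
    smul_hadamard, smul_inv_smul₀ (h₀ x₀)]
  rfl

end Kernels

end Matrix


namespace KernelSpace

open Matrix
open scoped ComplexOrder

variable {X H : Type*} [NormedAddCommGroup H] [InnerProductSpace ℂ H]

theorem inner_ker_ne_zero (K : KernelSpace X H) (x y : X) : inner ℂ (K.ker x) (K.ker y) ≠ 0 := by
  rcases eq_or_ne x y with rfl | h
  · exact inner_self_ne_zero.2 (K.ker.ne_zero x)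
  · exact K.irreducible x y h

theorem coe_ker_restrict (K : KernelSpace X H) (Y : Set X) (y : Y) :
    ((K.restrict Y).ker y : H) = K.ker y :=
  congrArg Subtype.val
    (Module.Basis.span_apply (K.ker.linearIndependent.comp _ Subtype.val_injective) y)

theorem gram_ker_restrict (K : KernelSpace X H) (Y : Set X) :
    Matrix.gram ℂ (K.restrict Y).ker = (Matrix.gram ℂ K.ker).submatrix (↑) (↑) := by
  ext x y
  rw [submatrix_apply, gram_apply, gram_apply, Submodule.coe_inner, coe_ker_restrict,
    coe_ker_restrict]

/-- The basis of `H ⊗ ℂˢ` formed by the vectors with `k_x` at coordinate `i` and zeros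
elsewhere. -/
noncomputable def kerBasis (K : KernelSpace X H) (s : ℕ) :
    Module.Basis (Fin s × X) ℂ (PiLp 2 fun _ : Fin s => H) :=
  ((Pi.basis fun _ : Fin s => K.ker).map (WithLp.linearEquiv 2 ℂ _).symm).reindex
    (Equiv.sigmaEquivProd (Fin s) X)

theorem kerBasis_apply (K : KernelSpace X H) {s : ℕ} (i : Fin s) (x : X) :
    K.kerBasis s (i, x) = WithLp.toLp 2 (Pi.single i (K.ker x)) := by
  simp [kerBasis]

/-- The kernel `(x, y) ↦ m(x) m(y)*` of a symbol `m` with values in the row vectors, written as the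
Gram matrix of the columns `m(x)*`. -/
noncomputable def rowKernel {t : ℕ} (m : X → Matrix (Fin 1) (Fin t) ℂ) : Matrix X X ℂ :=
  Matrix.gram ℂ fun x => (WithLp.toLp 2 (star (m x 0)) : EuclideanSpace ℂ (Fin t))

theorem rowKernel_star {t : ℕ} (b : X → EuclideanSpace ℂ (Fin t)) :
    rowKernel (fun x => of fun _ => star (b x).ofLp) = Matrix.gram ℂ b := by
  have h (x : X) : WithLp.toLp 2 (star (star (b x).ofLp)) = b x :=
    congrArg (WithLp.toLp 2) (star_star _)
  exact congrArg (Matrix.gram ℂ) (funext h)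

section Multiplier

variable [Finite X] {s t : ℕ}

theorem multiplier_adjoint_kerBasis [CompleteSpace H] (K : KernelSpace X H)
    (m : X → Matrix (Fin s) (Fin t) ℂ) (i : Fin s) (x : X) :
    (K.multiplier m).adjoint (K.kerBasis s (i, x)) =
      WithLp.toLp 2 fun j => conj (m x i j) • K.ker x := by
  refine ext_inner_right ℂ fun h => ?_
  calc inner ℂ ((K.multiplier m).adjoint (K.kerBasis s (i, x))) h
      = K.value (K.multiplier m h i) x := by
        rw [ContinuousLinearMap.adjoint_inner_left, kerBasis_apply, PiLp.inner_apply,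
          Fintype.sum_eq_single i fun j hj => by simp [hj]]
        simp [value]
    _ = inner ℂ (WithLp.toLp 2 fun j => conj (m x i j) • K.ker x) h := by
        rw [value_multiplier, PiLp.inner_apply]
        simp [Matrix.mulVec, dotProduct, inner_smul_left, value]

theorem norm_multiplier_le_one_iff (K : KernelSpace X H) (m : X → Matrix (Fin s) (Fin t) ℂ) :
    ‖K.multiplier m‖ ≤ 1 ↔ (of fun p q : Fin s × X =>
      (1 - m p.2 * (m q.2)ᴴ : Matrix (Fin s) (Fin s) ℂ) p.1 q.1 *
        inner ℂ (K.ker p.2) (K.ker q.2)).PosSemidef := by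
  have : FiniteDimensional ℂ H := Module.Basis.finiteDimensional_of_finite K.ker
  have : CompleteSpace H := FiniteDimensional.complete ℂ H
  have norm_adjoint : ‖(K.multiplier m).adjoint‖ = ‖K.multiplier m‖ :=
    LinearIsometryEquiv.norm_map ContinuousLinearMap.adjoint _
  rw [← norm_adjoint, norm_le_one_iff_posSemidef_gram_sub_gram (K.kerBasis s)]
  refine iff_of_eq (congrArg Matrix.PosSemidef ?_)
  ext ⟨i, x⟩ ⟨j, y⟩
  rw [Matrix.sub_apply, gram_apply, gram_apply, Function.comp_apply, Function.comp_apply,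
    multiplier_adjoint_kerBasis, multiplier_adjoint_kerBasis, kerBasis_apply, kerBasis_apply,
    PiLp.inner_apply, PiLp.inner_apply]
  have h_one : ∑ l, inner ℂ ((Pi.single i (K.ker x) : Fin s → H) l)
      ((Pi.single j (K.ker y) : Fin s → H) l) =
      (1 : Matrix (Fin s) (Fin s) ℂ) i j * inner ℂ (K.ker x) (K.ker y) := by
    rw [Fintype.sum_eq_single i fun l hl => by simp [hl]]
    rcases eq_or_ne i j with rfl | hij <;> simp [*]
  have h_mul : ∑ l, inner ℂ (conj (m x i l) • K.ker x) (conj (m y j l) • K.ker y) =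
      (m x * (m y)ᴴ) i j * inner ℂ (K.ker x) (K.ker y) := by
    rw [mul_apply, Finset.sum_mul]
    refine Finset.sum_congr rfl fun l _ => ?_
    rw [inner_smul_left, inner_smul_right, Complex.conj_conj, mul_assoc]
    rfl
  rw [h_one, h_mul, ← sub_mul]
  rfl

theorem multiplier_smul (K : KernelSpace X H) (a : ℂ) (m : X → Matrix (Fin s) (Fin t) ℂ) :
    K.multiplier (a • m) = a • K.multiplier m := by
  ext h i
  refine K.funEquiv.injective (funext fun x => ?_)
  rw [_root_.smul_apply, PiLp.smul_apply, map_smul, Pi.smul_apply, funEquiv_apply, funEquiv_apply,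
    value_multiplier, value_multiplier, Pi.smul_apply, smul_mulVec, Pi.smul_apply]

theorem multiplier_injective (K : KernelSpace X H) :
    Function.Injective (K.multiplier : (X → Matrix (Fin s) (Fin t) ℂ) → _) := by
  have : FiniteDimensional ℂ H := Module.Basis.finiteDimensional_of_finite K.ker
  have : CompleteSpace H := FiniteDimensional.complete ℂ H
  intro m m' h
  ext x i j
  have hx := (K.multiplier_adjoint_kerBasis m i x).symm.trans
    (h ▸ K.multiplier_adjoint_kerBasis m' i x)
  have hj := congrFun (WithLp.toLp_injective 2 hx) j
  exact star_injective (smul_left_injective ℂ (K.ker.ne_zero x) hj)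

-- The default depth is too small for the norm structure on operators between `PiLp` spaces.
set_option maxSynthPendingDepth 4 in
theorem norm_multiplier_smul (K : KernelSpace X H) (a : ℂ) (m : X → Matrix (Fin s) (Fin t) ℂ) :
    ‖K.multiplier (a • m)‖ = ‖a‖ * ‖K.multiplier m‖ := by
  rw [multiplier_smul, norm_smul]

set_option maxSynthPendingDepth 4 in
theorem norm_multiplier_eq_zero (K : KernelSpace X H) {m : X → Matrix (Fin s) (Fin t) ℂ} :
    ‖K.multiplier m‖ = 0 ↔ m = 0 := by
  have multiplier_zero : K.multiplier (0 : X → Matrix (Fin s) (Fin t) ℂ) = 0 := by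
    rw [← zero_smul ℂ (0 : X → Matrix (Fin s) (Fin t) ℂ), multiplier_smul, zero_smul]
  rw [norm_eq_zero, K.multiplier_injective.eq_iff' multiplier_zero]

theorem norm_row_multiplier_le_one_iff (K : KernelSpace X H)
    (m : X → Matrix (Fin 1) (Fin t) ℂ) :
    ‖K.multiplier m‖ ≤ 1 ↔
      (Matrix.gram ℂ K.ker - rowKernel m ⊙ Matrix.gram ℂ K.ker).PosSemidef := by
  rw [norm_multiplier_le_one_iff, ← posSemidef_submatrix_equiv (Equiv.uniqueProd X (Fin 1)).symm]
  refine iff_of_eq (congrArg Matrix.PosSemidef ?_)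
  ext x y
  have h : rowKernel m x y = (m x * (m y)ᴴ) 0 0 := by
    rw [rowKernel, gram_apply, EuclideanSpace.inner_toLp_toLp, star_star, dotProduct_comm]
    rfl
  rw [Matrix.sub_apply, hadamard_apply, h, gram_apply, ← one_sub_mul]
  rfl

/-- The Pick property for contractive multipliers whose symbols are row vectors. -/
def RowPick (K : KernelSpace X H) : Prop :=
  ∀ (t : ℕ) (Y : Set X) (w : Y → Matrix (Fin 1) (Fin t) ℂ), ‖(K.restrict Y).multiplier w‖ ≤ 1 →
    ∃ m : X → Matrix (Fin 1) (Fin t) ℂ, ‖K.multiplier m‖ ≤ 1 ∧ ∀ y : Y, m y = w y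

theorem CompletePick.rowPick {K : KernelSpace X H} (hK : K.CompletePick) : K.RowPick := by
  intro t Y w hw
  obtain rfl | hw₀ := eq_or_ne w 0
  · exact ⟨0, (K.norm_multiplier_eq_zero.2 rfl).trans_le zero_le_one, fun _ => rfl⟩
  · set r := ‖(K.restrict Y).multiplier w‖
    have hr : r ≠ 0 := mt (K.restrict Y).norm_multiplier_eq_zero.1 hw₀
    have hr_norm : ‖(r : ℂ)‖ = r := Complex.norm_of_nonneg (ContinuousLinearMap.opNorm_nonneg _)
    obtain ⟨m, hm, hmw⟩ := hK 1 t Y ((r : ℂ)⁻¹ • w) (by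
      rw [norm_multiplier_smul, norm_inv, hr_norm, inv_mul_cancel₀ hr])
    refine ⟨(r : ℂ) • m, ?_, fun y => ?_⟩
    · rwa [norm_multiplier_smul, hm, mul_one, hr_norm]
    · rw [Pi.smul_apply, hmw, Pi.smul_apply, smul_inv_smul₀ (Complex.ofReal_ne_zero.2 hr)]

end Multiplier

section McCulloughQuiggin

variable [Finite X] {K : KernelSpace X H}

theorem RowPick.posSemidef_submatrix_mcCulloughQuiggin (hK : K.RowPick) {S : Set X} {x₁ : X}
    (h₁ : ((mcCulloughQuiggin (Matrix.gram ℂ K.ker) x₁).submatrix ((↑) : S → X) (↑)).PosSemidef)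
    (x₀ : X) :
    ((mcCulloughQuiggin (Matrix.gram ℂ K.ker) x₀).submatrix ((↑) : S → X) (↑)).PosSemidef := by
  set G := Matrix.gram ℂ K.ker
  have hG : G.PosSemidef := posSemidef_gram ℂ _
  have hG₀ (x y : X) : G x y ≠ 0 := K.inner_ker_ne_zero x y
  obtain ⟨b, hb⟩ := exists_gram_eq_of_posSemidef h₁
  let w (y : S) : Matrix (Fin 1) (Fin (Nat.card S)) ℂ := of fun _ => star (b y).ofLp
  have hw : rowKernel w = (mcCulloughQuiggin G x₁).submatrix (↑) (↑) :=
    (rowKernel_star b).trans hb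
  obtain ⟨m, hm, hmw⟩ := hK _ S w <| by
    rw [norm_row_multiplier_le_one_iff, gram_ker_restrict, hw]
    have hR := (posSemidef_sub_vanishingKernel (x₀ := x₁) hG).submatrix ((↑) : S → X)
    rwa [← mcCulloughQuiggin_hadamard hG₀] at hR
  have hm_eq (x y : S) : rowKernel m x y = mcCulloughQuiggin G x₁ x y :=
    (congrFun₂ (congrArg rowKernel (funext hmw : m ∘ (↑) = w)) x y).trans (congrFun₂ hw x y)
  have hV := posSemidef_vanishingKernel_sub_hadamard (B := rowKernel m) (hG₀ x₀ x₀) hG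
    (posSemidef_gram ℂ _) ((K.norm_row_multiplier_le_one_iff m).1 hm)
  refine posSemidef_of_sub_vanishingKernel_hadamard (f := ((↑) : S → X)) hG (hG₀ · x₁) ?_
  convert hV.submatrix ((↑) : S → X) using 1
  ext x y
  have hV₀ := congrFun₂ (mcCulloughQuiggin_hadamard (x₀ := x₀) hG₀) (x : X) (y : X)
  have hV₁ := congrFun₂ (mcCulloughQuiggin_hadamard (x₀ := x₁) hG₀) (x : X) (y : X)
  rw [hadamard_apply] at hV₀ hV₁
  simp only [hadamard_apply, submatrix_apply, Matrix.sub_apply]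
  rw [← hV₀, ← hV₁, hm_eq]
  ring

theorem RowPick.posSemidef_mcCulloughQuiggin (hK : K.RowPick) (x₀ : X) :
    (mcCulloughQuiggin (Matrix.gram ℂ K.ker) x₀).PosSemidef := by
  have h (S : Set X) (x₀ : X) :
      ((mcCulloughQuiggin (Matrix.gram ℂ K.ker) x₀).submatrix ((↑) : S → X) (↑)).PosSemidef := by
    induction S, S.toFinite using Set.Finite.induction_on generalizing x₀ with
    | empty =>
      convert PosSemidef.zero
      exact Subsingleton.elim _ _
    | @insert x₁ S _ _ ih =>
      exact hK.posSemidef_submatrix_mcCulloughQuiggin (posSemidef_submatrix_insert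
        (mcCulloughQuiggin_self_left K.inner_ker_ne_zero)
        (mcCulloughQuiggin_self_right K.inner_ker_ne_zero) (ih x₁)) x₀
  exact (posSemidef_submatrix_equiv (Equiv.Set.univ X)).1 (h Set.univ x₀)

theorem RowPick.exists_inv_one_sub_inner_eq (hK : K.RowPick) (x₀ : X) :
    ∃ (b : X → EuclideanSpace ℂ (Fin (Nat.card X))) (γ : X → ℂ), (∀ x, γ x ≠ 0) ∧
      ∀ x y, (1 - inner ℂ (b x) (b y))⁻¹ = γ x * conj (γ y) * K.gram x y := by
  -- `inner` is conjugate-linear in its first argument: `K.gram` is the transpose of `Matrix.gram`.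
  obtain ⟨b, hb⟩ := exists_gram_eq_of_posSemidef (hK.posSemidef_mcCulloughQuiggin x₀).transpose
  refine ⟨b, fun x => ‖K.ker x₀‖ / inner ℂ (K.ker x₀) (K.ker x), fun x => div_ne_zero
    (Complex.ofReal_ne_zero.2 (norm_ne_zero_iff.2 (K.ker.ne_zero x₀)))
    (K.inner_ker_ne_zero x₀ x), fun x y => ?_⟩
  have hxy : inner ℂ (b x) (b y) = mcCulloughQuiggin (Matrix.gram ℂ K.ker) x₀ y x :=
    congrFun₂ hb x y
  rw [hxy, mcCulloughQuiggin, of_apply, sub_sub_cancel, inv_div, map_div₀, Complex.conj_ofReal,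
    inner_conj_symm, KernelSpace.gram, value]
  simp only [Matrix.gram_apply, inner_self_eq_norm_sq_to_K (K.ker x₀), Complex.coe_algebraMap]
  ring

end McCulloughQuiggin

section DruryArveson

variable {n : ℕ}

theorem gram_DA (Y : Set (CHyp n)) (x y : Y) :
    (DA n Y).gram x y = (1 - inner ℂ (x : EuclideanSpace ℂ (Fin n)) y)⁻¹ := by
  have coe_ker (y : Y) : ((DA n Y).ker y : DruryArveson n) = daKer (y : CHyp n) :=
    congrArg Subtype.val (Module.Basis.span_apply
      ((linearIndependent_daKer n).comp _ Subtype.val_injective) y)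
  rw [gram, value, Submodule.coe_inner, coe_ker, coe_ker, inner_daKer, daKer_apply]

variable {K : KernelSpace X H} {b : X → EuclideanSpace ℂ (Fin n)} {γ : X → ℂ}

theorem norm_lt_one_of_gram (hγ : ∀ x, γ x ≠ 0)
    (h : ∀ x y, (1 - inner ℂ (b x) (b y))⁻¹ = γ x * conj (γ y) * K.gram x y) (x : X) :
    ‖b x‖ < 1 := by
  have hx : (((1 - ‖b x‖ ^ 2)⁻¹ : ℝ) : ℂ) = ((‖γ x‖ ^ 2 * ‖K.ker x‖ ^ 2 : ℝ) : ℂ) := by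
    simpa [Complex.mul_conj', gram, value, inner_self_eq_norm_sq_to_K] using h x x
  have hpos : 0 < 1 - ‖b x‖ ^ 2 := by
    rw [← inv_pos, Complex.ofReal_injective hx]
    have := norm_pos_iff.2 (hγ x)
    have := norm_pos_iff.2 (K.ker.ne_zero x)
    positivity
  rw [← sq_lt_one_iff₀ (norm_nonneg _)]
  linarith

theorem injective_of_gram (hγ : ∀ x, γ x ≠ 0)
    (h : ∀ x y, (1 - inner ℂ (b x) (b y))⁻¹ = γ x * conj (γ y) * K.gram x y) :
    Function.Injective b := by
  intro x y hxy
  refine K.ker.linearIndependent.eq_of_smul_apply_eq_smul_apply (γ x) (γ y) x y (hγ x) ?_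
  refine InnerProductSpace.ext_inner_left_basis K.ker fun z => ?_
  have hz : γ x * conj (γ z) * K.gram x z = γ y * conj (γ z) * K.gram y z := by
    rw [← h, ← h, hxy]
  rw [inner_smul_right, inner_smul_right]
  simp only [gram, value] at hz
  refine mul_left_cancel₀ ((map_ne_zero (starRingEnd ℂ)).2 (hγ z)) ?_
  linear_combination hz

theorem exists_rescales_DA_range (hγ : ∀ x, γ x ≠ 0)
    (h : ∀ x y, (1 - inner ℂ (b x) (b y))⁻¹ = γ x * conj (γ y) * K.gram x y) :
    ∃ f : X → CHyp n, K.Rescales (DA n (Set.range f)) := by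
  let f (x : X) : CHyp n := ⟨b x, mem_ball_zero_iff.2 (norm_lt_one_of_gram hγ h x)⟩
  have hf : Function.Injective f := fun x y hxy =>
    injective_of_gram hγ h (congrArg Subtype.val hxy)
  exact ⟨f, Equiv.ofInjective f hf, γ, hγ, fun x y => (gram_DA _ _ _).trans (h x y)⟩

end DruryArveson

end KernelSpace

theorem theorem5p9_general {X H : Type*} [Finite X] [NormedAddCommGroup H]
    [InnerProductSpace ℂ H] (K : KernelSpace X H) (hK : K.RowPick) :
    ∃ n : ℕ, 1 ≤ n ∧ ∃ Y : Set (CHyp n), Y.Finite ∧ K.Rescales (DA n Y) := by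
  suffices ∃ n : ℕ, 1 ≤ n ∧ ∃ (b : X → EuclideanSpace ℂ (Fin n)) (γ : X → ℂ), (∀ x, γ x ≠ 0) ∧
      ∀ x y, (1 - inner ℂ (b x) (b y))⁻¹ = γ x * conj (γ y) * K.gram x y by
    obtain ⟨n, hn, b, γ, hγ, h⟩ := this
    obtain ⟨f, hf⟩ := KernelSpace.exists_rescales_DA_range hγ h
    exact ⟨n, hn, Set.range f, Set.finite_range f, hf⟩
  rcases isEmpty_or_nonempty X with _ | ⟨⟨x₀⟩⟩
  · exact ⟨1, le_rfl, isEmptyElim, isEmptyElim, isEmptyElim, isEmptyElim⟩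
  · have : Nonempty X := ⟨x₀⟩
    exact ⟨Nat.card X, Nat.card_pos, hK.exists_inv_one_sub_inner_eq x₀⟩

theorem theorem5p9 {X H : Type*} [Finite X] [NormedAddCommGroup H] [InnerProductSpace ℂ H]
    (K : KernelSpace X H) (hK : K.CompletePick) :
    ∃ n : ℕ, 1 ≤ n ∧ ∃ Y : Set (CHyp n), Y.Finite ∧ K.Rescales (DA n Y) :=
  theorem5p9_general K hK.rowPick
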